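/- Let $\mathbb{Z}_+^2=\{(i,j): i,j\ge 1 \text{ integers}\}$, let $B=\{1,\dots,m\}\times\{1,\dots,n\}$ be an $m\times n$ rectangle, and let $A\subset B$ be a Young diagram (a finite subset of $\mathbb{Z}_+^2$ that contains with $(i,j)$ every $(i',j')$ with $i'\le i$, $j'\le j$). Let $\mathcal S^{AB}$ be the set of skyscrapers on $\mathbb{Z}_+^2\setminus A$ vanishing outside $B$, i.e. functions $S:\mathbb{Z}_+^2\setminus A\to\{0,1,2,\dots\}$, $S=(n_{ij})$, that are non-increasing in each variable and zero outside $B$. The volume of $S$ is $\mathrm{vol}(S)=\sum n_{ij}$. Fix an enumeration $c_1\succ c_2\succ\cdots$ of all cells of $\mathbb{Z}_+^2$ that is allowed, i.e. for every $k$ the array with value $\max(k-l,0)$ at $c_l$ is non-increasing in each variable, and such that every cell of $A$ precedes every cell of $B\setminus A$ and every cell of $B$ precedes every cell outside $B$. For $S\in\mathcal S^{AB}$ define an ordering $\succ_S$ of $\mathbb{Z}_+^2\setminus A$ by: $c\succ_S c'$ iff $S(c)>S(c')$, or $S(c)=S(c')$ and $c\succ c'$. Write $S\sim S'$ if $\succ_S$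 and $\succ_{S'}$ coincide. A skyscraper $P\in\mathcal S^{AB}$ is a pedestal if $S\ge P$ pointwise for every $S\in\mathcal S^{AB}$ with $S\sim P$; let $\mathcal P^{AB}$ be the set of pedestals. For $b\in B\setminus A$ let the hook length $h(b)$ be $1$ plus the number of cells $(i',j')\in B\setminus A$ with $i'=i$, $j'<j$ or with $j'=j$, $i'<i$, where $b=(i,j)$. Then $\mathcal P^{AB}$ is finite, and its generating polynomial $\mathfrak g_{\mathcal P^{AB}}(x)=\sum_{P\in\mathcal P^{AB}}x^{\mathrm{vol}(P)}$ satisfies $$\mathfrak g_{\mathcal P^{AB}}(x)=\frac{\prod_{l=1}^{|B\setminus A|}(1-x^l)}{\prod_{b\in B\setminus A}(1-x^{h(b)})}$$ as rational functions. In particular, for $A=\emptyset$, $$\mathfrak g_{\mathcal P^{m\times n}}(x)=\frac{\prod_{l=1}^{mn}(1-x^l)}{\prod_{i=1}^m\prod_{j=1}^n(1-x^{i+j-1})}.$$ -/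

import Mathlib

open Finset Polynomial

/-! The quadrant of cells `(i, j)`, `i, j ≥ 1`, is modelled by `ℕ × ℕ`, as in Mathlib's
`YoungDiagram`: the pair `(i, j) : ℕ × ℕ` stands for the cell `(i + 1, j + 1)`. -/

namespace Skyscraper

/-- A plane partition of an integer: an array of non-negative integers, non-increasing in each
variable, with finitely many nonzero entries. -/
def IsPlanePartition (n : ℕ × ℕ → ℕ) : Prop :=
  Antitone n ∧ n.support.Finite

/-- A complete ordering `e 0 ≻ e 1 ≻ e 2 ≻ ⋯` of all cells is *allowed* if, for every `k`, the
array with value `k - l` at the `l`-th cell for `l ≤ k` (`l = 1, 2, …`), and value `0` at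
the other cells, is a plane partition. The cell `c` is the `(e.symm c + 1)`-st one. -/
def IsAllowed (e : ℕ ≃ ℕ × ℕ) : Prop :=
  ∀ k : ℕ, IsPlanePartition fun c => k - (e.symm c + 1)

/-- `c ≻ c'`: the cell `c` precedes the cell `c'` in the ordering `e 0 ≻ e 1 ≻ e 2 ≻ ⋯`. -/
def Precedes (e : ℕ ≃ ℕ × ℕ) (c c' : ℕ × ℕ) : Prop :=
  e.symm c < e.symm c'

/-- The orderings used for a pair of diagrams `A ⊆ B`: the allowed ones in which the cells of `A`
precede those of `B \ A`, and the cells of `B` precede those outside `B`. -/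
structure IsAllowedFor (A B : YoungDiagram) (e : ℕ ≃ ℕ × ℕ) : Prop where
  allowed : IsAllowed e
  inner_first : ∀ a ∈ A, ∀ b ∈ B, b ∉ A → Precedes e a b
  outer_last : ∀ b ∈ B, ∀ c, c ∉ B → Precedes e b c

/-- The cells of the quadrant that do not belong to `A`. -/
abbrev Outside (A : YoungDiagram) : Type := {c : ℕ × ℕ // c ∉ A}

/-- Skyscrapers on the complement of `A` that vanish outside `B`. As the complement of a Young
diagram is an upper set, being non-increasing along all rows and columns
is the same as being antitone for the product order. -/
structure IsSkyscraper (A B : YoungDiagram) (S : Outside A → ℕ) : Prop where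
  antitone : Antitone S
  eq_zero : ∀ c : Outside A, c.1 ∉ B → S c = 0

/-- The ordering `≻_S`: higher cells first, ties being broken by the fixed ordering `≻`. -/
def PrecedesIn (e : ℕ ≃ ℕ × ℕ) {A : YoungDiagram} (S : Outside A → ℕ) (c c' : Outside A) : Prop :=
  S c' < S c ∨ (S c = S c' ∧ Precedes e c.1 c'.1)

/-- `S ∼ S'`: the two skyscrapers define the same ordering of the cells. -/
def Equivalent (e : ℕ ≃ ℕ × ℕ) {A : YoungDiagram} (S S' : Outside A → ℕ) : Prop :=
  ∀ c c' : Outside A, PrecedesIn e S c c' ↔ PrecedesIn e S' c c'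

/-- The set of pedestals: skyscrapers lying below every skyscraper equivalent to them. -/
def pedestals (e : ℕ ≃ ℕ × ℕ) (A B : YoungDiagram) : Set (Outside A → ℕ) :=
  {P | IsSkyscraper A B P ∧ ∀ S, IsSkyscraper A B S → Equivalent e S P → ∀ c, P c ≤ S c}

/-- The volume, i.e. the sum of all heights. -/
noncomputable def vol {A : YoungDiagram} (S : Outside A → ℕ) : ℕ :=
  ∑ᶠ c, S c

/-- The generating polynomial of the pedestals, `∑ x ^ vol P` over all pedestals `P`
(a genuine sum as soon as the set of pedestals is finite). -/
noncomputable def pedestalPolynomial (e : ℕ ≃ ℕ × ℕ) (A B : YoungDiagram) : ℚ[X] :=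
  ∑ᶠ P ∈ pedestals e A B, X ^ vol P

/-- The hook length of the cell `b` of `B \ A`; the hook runs from `b` towards the coordinate axes
and stays in `B \ A`. -/
def hookLength (A B : YoungDiagram) (b : ℕ × ℕ) : ℕ :=
  #{c ∈ B.cells \ A.cells | c.1 = b.1 ∧ c.2 < b.2} +
    #{c ∈ B.cells \ A.cells | c.2 = b.2 ∧ c.1 < b.1} + 1

/-- The `m × n` rectangle. -/
def rectangle (m n : ℕ) : YoungDiagram where
  cells := range m ×ˢ range n
  isLowerSet := by
    intro a b hba ha
    simp only [coe_product, coe_range, Set.mem_prod, Set.mem_Iio] at ha ⊢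
    exact ⟨lt_of_le_of_lt hba.1 ha.1, lt_of_le_of_lt hba.2 ha.2⟩

end Skyscraper

/-!
The generating function of all skyscrapers is computed in two ways.

*Through pedestals.* Each class of equivalent skyscrapers has a least element, its pedestal `P`
(`exists_pedestal`), and the members of the class are the sums `P + τ` with `τ` non-increasing along
the total ordering `≻_P` of the `N = |B \ A|` cells (`pedestal_sub_le`, `pedestalEquiv`). Such a `τ`
is a partition into at most `N` parts, so the generating function of all skyscrapers is that of
the pedestals times `∏ l ∈ Icc 1 N, (1 - x ^ l)⁻¹` (`tsum_pow_vol_eq_mul`).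

*Through hooks.* As `B` is a rectangle, skyscrapers are reverse plane partitions of the shape
`B \ A` rotated by a half turn, whose generating function is `∏ b, (1 - x ^ h b)⁻¹` (`tsum_pow_vol`).
The proof adds the cells of `B \ A` to `A` one at a time. If `(r, s)` is a minimal cell
of the complement of `A`, toggling the values on its diagonal, by the involution
`v ↦ min (previous two) + max (next two) - v`, identifies skyscrapers for `A` with pairs of a
number `k` and a skyscraper for `A ∪ {(r, s)}` (`toggleEquiv`). To make the induction close, cells of
the diagonal `t = j - i` are given the weight `W (t + 1) - W t` for an arbitrary function `W : ℤ → ℤ`.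
Since `min u v + max u v = u + v`, the toggle acts on weights by exchanging the values `W (s - r)`
and `W (s - r + 1)` (`diagWeight_toggle`). The weight of a hook is a difference of two values of `W`,
and it is invariant under this exchange (`IsCorner.hookWeight_swap`).

Generating functions are sums in `ℝ≥0∞`, where no summability has to be checked. The comparison
at all points of `(0, 1)` then gives the identity of polynomials.
-/

open scoped ENNReal

namespace Skyscraper

/-! ### Toggling a diagonal -/

lemma mem_rectangle {m n i j : ℕ} : (i, j) ∈ rectangle m n ↔ i < m ∧ j < n := by
  change (i, j) ∈ range m ×ˢ range n ↔ _
  simp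

/-- Skyscrapers over the complement of `A` and vanishing outside the `m × n` rectangle, extended by
`0` to `A` so that they become functions on the whole quadrant. Monotonicity is only required
between neighbouring cells, and not at the cells of `A`. -/
structure IsPadded (A : YoungDiagram) (m n : ℕ) (S : ℕ × ℕ → ℕ) : Prop where
  inner : ∀ c ∈ A, S c = 0
  outer : ∀ i j, m ≤ i ∨ n ≤ j → S (i, j) = 0
  row : ∀ i j, (i, j) ∉ A → S (i, j + 1) ≤ S (i, j)
  col : ∀ i j, (i, j) ∉ A → S (i + 1, j) ≤ S (i, j)

/-- Toggling along the diagonal that starts at `(r, s)`: every cell of the diagonal strictly beyond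
`(r, s)` is reflected in the interval of values which its four neighbours allow, the cell `(r, s)`
gets the value `v`, and all other cells are unchanged. -/
def toggle (r s v : ℕ) (S : ℕ × ℕ → ℕ) (c : ℕ × ℕ) : ℕ :=
  if c = (r, s) then v
  else if r < c.1 ∧ c.2 + r = c.1 + s then
    min (S (c.1 - 1, c.2)) (S (c.1, c.2 - 1)) + max (S (c.1 + 1, c.2)) (S (c.1, c.2 + 1)) - S c
  else S c

section Toggle

variable {r s : ℕ}

@[simp] lemma toggle_corner (v : ℕ) (S : ℕ × ℕ → ℕ) : toggle r s v S (r, s) = v := by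
  simp [toggle]

@[simp] lemma toggle_diagonal (v : ℕ) (S : ℕ × ℕ → ℕ) (k : ℕ) :
    toggle r s v S (r + k + 1, s + k + 1) =
      min (S (r + k, s + k + 1)) (S (r + k + 1, s + k)) +
        max (S (r + k + 2, s + k + 1)) (S (r + k + 1, s + k + 2)) -
        S (r + k + 1, s + k + 1) := by
  have h1 : ¬ ((r + k + 1, s + k + 1) = (r, s)) := by
    simp only [Prod.mk.injEq]; omega
  have h2 : r < r + k + 1 ∧ s + k + 1 + r = r + k + 1 + s := by omega
  simp only [toggle, h1, h2, if_false]
  simp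

lemma toggle_of_off_diagonal (v : ℕ) (S : ℕ × ℕ → ℕ) {i j : ℕ}
    (h : i < r ∨ j + r ≠ i + s) : toggle r s v S (i, j) = S (i, j) := by
  have h1 : ¬ ((i, j) = (r, s)) := by
    simp only [Prod.mk.injEq]; omega
  have h2 : ¬ (r < i ∧ j + r = i + s) := by omega
  simp only [toggle, h1, h2, if_false]

/-- The three cases in the definition of `toggle`. -/
lemma diagonal_cases (r s i j : ℕ) :
    (i = r ∧ j = s) ∨ (∃ k, i = r + k + 1 ∧ j = s + k + 1) ∨ (i < r ∨ j + r ≠ i + s) := by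
  by_cases h : i < r ∨ j + r ≠ i + s
  · exact Or.inr (Or.inr h)
  · rcases Nat.lt_or_ge r i with h' | h'
    · exact Or.inr (Or.inl ⟨i - r - 1, by omega, by omega⟩)
    · exact Or.inl (by omega)

lemma toggle_toggle (u v : ℕ) (S : ℕ × ℕ → ℕ)
    (hS : ∀ k, S (r + k + 1, s + k + 1) ≤
      min (S (r + k, s + k + 1)) (S (r + k + 1, s + k))) :
    toggle r s u (toggle r s v S) = Function.update S (r, s) u := by
  funext ⟨i, j⟩
  rcases diagonal_cases r s i j with ⟨rfl, rfl⟩ | ⟨k, rfl, rfl⟩ | h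
  · simp
  · have hk := hS k
    rw [toggle_diagonal, toggle_diagonal, toggle_of_off_diagonal v S (by omega),
      toggle_of_off_diagonal v S (by omega), toggle_of_off_diagonal v S (by omega),
      toggle_of_off_diagonal v S (by omega),
      Function.update_of_ne (by simp only [ne_eq, Prod.mk.injEq]; omega)]
    omega
  · rw [toggle_of_off_diagonal _ _ h, toggle_of_off_diagonal _ _ h,
      Function.update_of_ne (by simp only [ne_eq, Prod.mk.injEq]; omega)]

variable {A A' A'' : YoungDiagram} {m n : ℕ} {S : ℕ × ℕ → ℕ}

/-- `A'` is obtained from `A` by adding the cell `(r, s)` of the `m × n` rectangle. As both are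
Young diagrams, `(r, s)` is then a minimal cell of the complement of `A`. -/
structure IsCorner (A A' : YoungDiagram) (m n r s : ℕ) : Prop where
  notMem : (r, s) ∉ A
  mem_iff : ∀ c, c ∈ A' ↔ c = (r, s) ∨ c ∈ A
  lt_row : r < m
  lt_col : s < n

namespace IsCorner

lemma mem_of_lt_col (h : IsCorner A A' m n r s) {j : ℕ} (hj : j < s) : (r, j) ∈ A := by
  have h1 : (r, j) ∈ A' := A'.up_left_mem le_rfl hj.le ((h.mem_iff _).2 (Or.inl rfl))
  rcases (h.mem_iff _).1 h1 with h2 | h2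
  · simp only [Prod.mk.injEq] at h2; omega
  · exact h2

lemma mem_of_lt_row (h : IsCorner A A' m n r s) {i : ℕ} (hi : i < r) : (i, s) ∈ A := by
  have h1 : (i, s) ∈ A' := A'.up_left_mem hi.le le_rfl ((h.mem_iff _).2 (Or.inl rfl))
  rcases (h.mem_iff _).1 h1 with h2 | h2
  · simp only [Prod.mk.injEq] at h2; omega
  · exact h2

lemma notMem_of_le (h : IsCorner A A' m n r s) {i j : ℕ} (hi : r ≤ i) (hj : s ≤ j) :
    (i, j) ∉ A := fun hc => h.notMem (A.up_left_mem hi hj hc)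

lemma notMem_of_le_of_ne (h : IsCorner A A' m n r s) {i j : ℕ} (hi : r ≤ i) (hj : s ≤ j)
    (hne : i ≠ r ∨ j ≠ s) : (i, j) ∉ A' := by
  intro hc
  rcases (h.mem_iff _).1 hc with h2 | h2
  · simp only [Prod.mk.injEq] at h2; omega
  · exact h.notMem_of_le hi hj h2

end IsCorner

/-- A cell of the diagonal strictly beyond the corner is at most its two lower neighbours, so that
the truncated subtraction in `toggle` is a genuine one. -/
lemma IsPadded.diagonal_le (h : IsCorner A A' m n r s) (hA : A'' = A ∨ A'' = A')
    (hS : IsPadded A'' m n S) (k : ℕ) :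
    S (r + k + 1, s + k + 1) ≤ min (S (r + k, s + k + 1)) (S (r + k + 1, s + k)) := by
  have h1 : (r + k, s + k + 1) ∉ A'' := by
    rcases hA with rfl | rfl
    · exact h.notMem_of_le (by omega) (by omega)
    · exact h.notMem_of_le_of_ne (by omega) (by omega) (by omega)
  have h2 : (r + k + 1, s + k) ∉ A'' := by
    rcases hA with rfl | rfl
    · exact h.notMem_of_le (by omega) (by omega)
    · exact h.notMem_of_le_of_ne (by omega) (by omega) (by omega)
  exact le_min (hS.col _ _ h1) (hS.row _ _ h2)

lemma IsPadded.le_max (h : IsCorner A A' m n r s) (hA : A'' = A ∨ A'' = A')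
    (hS : IsPadded A'' m n S) (k : ℕ) :
    S (r + k + 2, s + k + 1) ≤ S (r + k + 1, s + k + 1) ∧
      S (r + k + 1, s + k + 2) ≤ S (r + k + 1, s + k + 1) := by
  have h1 : (r + k + 1, s + k + 1) ∉ A'' := by
    rcases hA with rfl | rfl
    · exact h.notMem_of_le (by omega) (by omega)
    · exact h.notMem_of_le_of_ne (by omega) (by omega) (by omega)
  exact ⟨hS.col _ _ h1, hS.row _ _ h1⟩

/-- Toggling passes between the skyscrapers for `A` and those for `A'`, in both directions: the only
condition is on the new value at the corner. -/
lemma IsPadded.toggle (h : IsCorner A A' m n r s) (hA : A'' = A ∨ A'' = A')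
    (hS : IsPadded A'' m n S) {C : YoungDiagram} {v : ℕ}
    (hC : (C = A' ∧ v = 0) ∨ (C = A ∧ max (S (r + 1, s)) (S (r, s + 1)) ≤ v)) :
    IsPadded C m n (toggle r s v S) := by
  have hAC : ∀ c ∈ A, c ∈ C := by
    rcases hC with ⟨rfl, -⟩ | ⟨rfl, -⟩
    · exact fun c hc => (h.mem_iff c).2 (Or.inr hc)
    · exact fun c hc => hc
  have hAA : ∀ c ∈ A, c ∈ A'' := by
    rcases hA with rfl | rfl
    · exact fun c hc => hc
    · exact fun c hc => (h.mem_iff c).2 (Or.inr hc)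
  have hCA : ∀ c, c ∈ C ∨ c ∈ A'' → c = (r, s) ∨ c ∈ A := by
    have h1 : ∀ c, c ∈ C → c = (r, s) ∨ c ∈ A := by
      rcases hC with ⟨rfl, -⟩ | ⟨rfl, -⟩
      · exact fun c hc => (h.mem_iff c).1 hc
      · exact fun c hc => Or.inr hc
    have h2 : ∀ c, c ∈ A'' → c = (r, s) ∨ c ∈ A := by
      rcases hA with rfl | rfl
      · exact fun c hc => Or.inr hc
      · exact fun c hc => (h.mem_iff c).1 hc
    exact fun c hc => hc.elim (h1 c) (h2 c)
  have hoff : ∀ i j, (i, j) ∉ C → (i < r ∨ j + r ≠ i + s) → (i, j) ∉ A'' := by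
    intro i j hij hne hc
    rcases hCA _ (Or.inr hc) with h1 | h1
    · simp only [Prod.mk.injEq] at h1; omega
    · exact hij (hAC _ h1)
  have hcorner : (r, s) ∉ C → S (r + 1, s) ≤ v ∧ S (r, s + 1) ≤ v := by
    rcases hC with ⟨rfl, -⟩ | ⟨rfl, h2⟩
    · exact fun h1 => absurd ((h.mem_iff _).2 (Or.inl rfl)) h1
    · exact fun _ => max_le_iff.1 h2
  refine ⟨?_, ?_, ?_, ?_⟩
  · rintro ⟨i, j⟩ hc
    rcases diagonal_cases r s i j with ⟨rfl, rfl⟩ | ⟨k, rfl, rfl⟩ | hd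
    · rw [toggle_corner]
      rcases hC with ⟨-, h2⟩ | ⟨rfl, -⟩
      · exact h2
      · exact absurd hc h.notMem
    · rcases hCA _ (Or.inl hc) with h1 | h1
      · simp only [Prod.mk.injEq] at h1; omega
      · exact absurd h1 (h.notMem_of_le (by omega) (by omega))
    · rw [toggle_of_off_diagonal _ _ hd]
      rcases hCA _ (Or.inl hc) with h1 | h1
      · simp only [Prod.mk.injEq] at h1; omega
      · exact hS.inner _ (hAA _ h1)
  · intro i j hij
    rcases diagonal_cases r s i j with ⟨rfl, rfl⟩ | ⟨k, rfl, rfl⟩ | hd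
    · have := h.lt_row; have := h.lt_col; omega
    · rw [toggle_diagonal, hS.outer (r + k + 2) (s + k + 1) (by omega),
        hS.outer (r + k + 1) (s + k + 2) (by omega)]
      rcases hij with hij | hij
      · rw [hS.outer (r + k + 1) (s + k) (by omega)]; simp
      · rw [hS.outer (r + k) (s + k + 1) (by omega)]; simp
    · rw [toggle_of_off_diagonal _ _ hd]
      exact hS.outer i j hij
  · intro i j hij
    rcases diagonal_cases r s i j with ⟨rfl, rfl⟩ | ⟨k, rfl, rfl⟩ | hd
    · rw [toggle_corner, toggle_of_off_diagonal _ _ (by omega)]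
      exact (hcorner hij).2
    · have h1 := hS.diagonal_le h hA k
      rw [toggle_diagonal, toggle_of_off_diagonal _ _ (by omega)]
      change S (r + k + 1, s + k + 2) ≤ _
      omega
    · rw [toggle_of_off_diagonal _ _ hd]
      rcases diagonal_cases r s i (j + 1) with ⟨rfl, rfl⟩ | ⟨k, rfl, hk⟩ | hd'
      · exact absurd (hAC _ (h.mem_of_lt_col (by omega))) hij
      · obtain rfl : j = s + k := by omega
        have h1 := hS.le_max h hA k
        rw [toggle_diagonal]
        omega
      · rw [toggle_of_off_diagonal _ _ hd']
        exact hS.row _ _ (hoff _ _ hij hd)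
  · intro i j hij
    rcases diagonal_cases r s i j with ⟨rfl, rfl⟩ | ⟨k, rfl, rfl⟩ | hd
    · rw [toggle_corner, toggle_of_off_diagonal _ _ (by omega)]
      exact (hcorner hij).1
    · have h1 := hS.diagonal_le h hA k
      rw [toggle_diagonal, toggle_of_off_diagonal _ _ (by omega)]
      change S (r + k + 2, s + k + 1) ≤ _
      omega
    · rw [toggle_of_off_diagonal _ _ hd]
      rcases diagonal_cases r s (i + 1) j with ⟨h1, rfl⟩ | ⟨k, hk, rfl⟩ | hd'
      · exact absurd (hAC _ (h.mem_of_lt_row (by omega))) hij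
      · obtain rfl : i = r + k := by omega
        have h1 := hS.le_max h hA k
        rw [toggle_diagonal]
        omega
      · rw [toggle_of_off_diagonal _ _ hd']
        exact hS.col _ _ (hoff _ _ hij hd)

/-- A skyscraper for `A` amounts to a skyscraper for `A ∪ {(r, s)}`, the toggled one, together with
the excess of its height at `(r, s)` over the larger of the two next heights, which is an arbitrary
number. -/
def toggleEquiv (h : IsCorner A A' m n r s) :
    {S // IsPadded A m n S} ≃ ℕ × {S // IsPadded A' m n S} where
  toFun S := (S.1 (r, s) - max (S.1 (r + 1, s)) (S.1 (r, s + 1)),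
    ⟨Skyscraper.toggle r s 0 S.1, S.2.toggle h (Or.inl rfl) (Or.inl ⟨rfl, rfl⟩)⟩)
  invFun p := ⟨Skyscraper.toggle r s (p.1 + max (p.2.1 (r + 1, s)) (p.2.1 (r, s + 1))) p.2.1,
    p.2.2.toggle h (Or.inr rfl) (Or.inr ⟨rfl, by omega⟩)⟩
  left_inv S := by
    apply Subtype.ext
    have h1 := S.2.row _ _ h.notMem
    have h2 := S.2.col _ _ h.notMem
    have h3 := toggle_toggle (r := r) (s := s) (S.1 (r, s)) 0 S.1 (S.2.diagonal_le h (Or.inl rfl))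
    rw [Function.update_eq_self] at h3
    simp only
    rw [toggle_of_off_diagonal _ _ (by omega), toggle_of_off_diagonal _ _ (by omega),
      Nat.sub_add_cancel (max_le h2 h1), h3]
  right_inv p := by
    obtain ⟨k, S, hS⟩ := p
    have h1 : S (r, s) = 0 := hS.inner _ ((h.mem_iff _).2 (Or.inl rfl))
    have h3 := toggle_toggle (r := r) (s := s) 0 (k + max (S (r + 1, s)) (S (r, s + 1))) S
      (hS.diagonal_le h (Or.inr rfl))
    rw [← h1, Function.update_eq_self, h1] at h3
    simp only [h3, toggle_corner]
    rw [toggle_of_off_diagonal _ _ (by omega), toggle_of_off_diagonal _ _ (by omega)]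
    simp

end Toggle

/-! ### Weights depending on the diagonal -/

/-- A weighted volume, in which the cells of the diagonal `j - i = t` have weight
`W (t + 1) - W t`. The usual volume is the case `W = id`. -/
def diagWeight (W : ℤ → ℤ) (m n : ℕ) (S : ℕ × ℕ → ℕ) : ℤ :=
  ∑ c ∈ range m ×ˢ range n, (W (c.2 - c.1 + 1) - W (c.2 - c.1)) * S c

/-- The sum over one diagonal of the rectangle, as a sum along a ray which starts at `(a, b)`. Terms
beyond the rectangle or before the start vanish by hypothesis. -/
lemma sum_diagonal (m n a b N : ℕ) (F : ℕ × ℕ → ℤ) (hN : m ≤ N)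
    (houter : ∀ i j, m ≤ i ∨ n ≤ j → F (i, j) = 0)
    (hinner : ∀ i j, j + a = i + b → i < a → F (i, j) = 0) :
    ∑ c ∈ range m ×ˢ range n, (if (c.2 : ℤ) - c.1 = b - a then F c else 0) =
      ∑ k ∈ range N, F (a + k, b + k) := by
  symm
  apply Finset.sum_bij_ne_zero (fun k _ _ => (a + k, b + k))
  · intro k _ hk
    simp only [mem_product, mem_range]
    by_contra hc
    exact hk (houter _ _ (by omega))
  · intro k _ _ l _ _ hkl
    simp only [Prod.mk.injEq] at hkl; omega
  · rintro ⟨i, j⟩ hij h0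
    simp only [mem_product, mem_range] at hij
    have h1 : (j : ℤ) - i = b - a := by
      by_contra h1; simp [h1] at h0
    simp only [h1, if_true] at h0
    have h2 : ¬ i < a := fun h2 => h0 (hinner i j (by omega) h2)
    have h3 : (a + (i - a), b + (i - a)) = (i, j) := by
      simp only [Prod.mk.injEq]; omega
    exact ⟨i - a, by simp only [mem_range]; omega, by rw [h3]; exact h0, h3⟩
  · intro k _ _
    simp

variable {r s m n : ℕ} {A A' : YoungDiagram} {S : ℕ × ℕ → ℕ}

/-- The sum of a diagonal before and after toggling equals, up to boundary terms, the sum of the two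
adjacent diagonals: `min + max` of two neighbouring values is their sum. -/
lemma sum_toggle_diagonal (v N : ℕ)
    (hS : ∀ k, S (r + k + 1, s + k + 1) ≤
      min (S (r + k, s + k + 1)) (S (r + k + 1, s + k))) (h0 : S (r, s) = 0) :
    ∑ k ∈ range (N + 1), ((toggle r s v S (r + k, s + k) : ℤ) + S (r + k, s + k)
        - S (r + 1 + k, s + k) - S (r + k, s + 1 + k)) =
      v - max (S (r + 1, s) : ℤ) (S (r, s + 1)) -
        min (S (r + 1 + N, s + N) : ℤ) (S (r + N, s + 1 + N)) := by
  induction N with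
  | zero =>
    simp [h0]
    have := min_add_max (S (r + 1, s) : ℤ) (S (r, s + 1))
    omega
  | succ N ih =>
    rw [sum_range_succ, ih]
    have hk := hS N
    have e1 : (r + (N + 1), s + (N + 1)) = (r + N + 1, s + N + 1) := rfl
    have e2 : (r + 1 + (N + 1), s + (N + 1)) = (r + N + 2, s + N + 1) := by
      simp only [Prod.mk.injEq]; omega
    have e3 : (r + (N + 1), s + 1 + (N + 1)) = (r + N + 1, s + N + 2) := by
      simp only [Prod.mk.injEq]; omega
    have e4 : (r + 1 + N, s + N) = (r + N + 1, s + N) := by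
      rw [Nat.add_right_comm]
    have e5 : (r + N, s + 1 + N) = (r + N, s + N + 1) := by
      rw [Nat.add_right_comm]
    rw [e1, e2, e3, e4, e5, toggle_diagonal]
    omega

/-- Undoing a toggle in terms of weights: up to the contribution of the excess `k`, it amounts to
exchanging the values of `W` at the two ends of the toggled diagonal. -/
lemma diagWeight_toggle (h : IsCorner A A' m n r s) (hS : IsPadded A' m n S) (W : ℤ → ℤ) (k : ℕ) :
    diagWeight W m n (toggle r s (k + max (S (r + 1, s)) (S (r, s + 1))) S) =
      k * (W (s - r + 1) - W (s - r)) +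
        diagWeight (W ∘ Equiv.swap ((s : ℤ) - r) (s - r + 1)) m n S := by
  set v := k + max (S (r + 1, s)) (S (r, s + 1)) with hv
  have hT : IsPadded A m n (toggle r s v S) :=
    hS.toggle h (Or.inr rfl) (Or.inr ⟨rfl, by omega⟩)
  have key := sum_toggle_diagonal v (m + n) (hS.diagonal_le h (Or.inr rfl))
    (hS.inner _ ((h.mem_iff _).2 (Or.inl rfl)))
  rw [hS.outer (r + 1 + (m + n)) _ (by omega), hS.outer (r + (m + n)) _ (by omega)] at key
  simp only [sum_sub_distrib, sum_add_distrib] at key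
  -- On the diagonal of the corner and the two adjacent ones, the cells before the corner lie in `A`.
  have hin : ∀ i j, j + r ≤ i + s + 1 → i + s ≤ j + r + 1 → (i < r ∨ j < s) → (i, j) ∈ A := by
    intro i j h1 h2 h3
    rcases Nat.lt_or_ge i r with hi | hi
    · exact A.up_left_mem le_rfl (by omega) (h.mem_of_lt_row hi)
    · exact A.up_left_mem (by omega) le_rfl (h.mem_of_lt_col (j := j) (by omega))
  have hin' : ∀ i j, j + r ≤ i + s + 1 → i + s ≤ j + r + 1 → (i < r ∨ j < s) → S (i, j) = 0 :=
    fun i j h1 h2 h3 => hS.inner _ ((h.mem_iff _).2 (Or.inr (hin i j h1 h2 h3)))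
  rw [← sum_diagonal m n r s (m + n + 1) (fun c => (toggle r s v S c : ℤ)) (by omega)
      (fun i j hij => by exact_mod_cast hT.outer i j hij)
      (fun i j h1 h2 => by
        exact_mod_cast hT.inner _ (hin i j (by omega) (by omega) (by omega))),
    ← sum_diagonal m n r s (m + n + 1) (fun c => (S c : ℤ)) (by omega)
      (fun i j hij => by exact_mod_cast hS.outer i j hij)
      (fun i j h1 h2 => by exact_mod_cast hin' i j (by omega) (by omega) (by omega)),
    ← sum_diagonal m n (r + 1) s (m + n + 1) (fun c => (S c : ℤ)) (by omega)
      (fun i j hij => by exact_mod_cast hS.outer i j hij)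
      (fun i j h1 h2 => by exact_mod_cast hin' i j (by omega) (by omega) (by omega)),
    ← sum_diagonal m n r (s + 1) (m + n + 1) (fun c => (S c : ℤ)) (by omega)
      (fun i j hij => by exact_mod_cast hS.outer i j hij)
      (fun i j h1 h2 => by exact_mod_cast hin' i j (by omega) (by omega) (by omega)),
    ← sum_add_distrib, ← sum_sub_distrib, ← sum_sub_distrib] at key
  have hk : (k : ℤ) = v - max (S (r + 1, s) : ℤ) (S (r, s + 1)) -
      min ((0 : ℕ) : ℤ) ((0 : ℕ) : ℤ) := by
    simp [hv]
  -- `k` is now a sum over the rectangle, and the claim holds term by term.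
  rw [hk, ← key, sum_mul, diagWeight, diagWeight, ← sum_add_distrib]
  refine sum_congr rfl ?_
  rintro ⟨i, j⟩ -
  simp only [Function.comp]
  set κ : ℤ := (s : ℤ) - r with hκ
  have hd : (j : ℤ) - i ≠ κ → toggle r s v S (i, j) = S (i, j) := fun hne =>
    toggle_of_off_diagonal _ _ (by omega)
  push_cast
  rw [show (s : ℤ) - (r + 1) = κ - 1 by omega, show (s : ℤ) + 1 - r = κ + 1 by omega]
  generalize (j : ℤ) - i = t at *
  by_cases h1 : t = κ
  · subst h1
    simp [show ¬ κ = κ - 1 by omega]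
    ring
  · rw [hd h1]
    by_cases h2 : t = κ - 1
    · subst h2
      rw [Equiv.swap_apply_of_ne_of_ne (a := κ) (b := κ + 1) (x := κ - 1) (by omega) (by omega)]
      simp
      rw [if_neg (by omega)]
      ring
    by_cases h3 : t = κ + 1
    · subst h3
      rw [Equiv.swap_apply_of_ne_of_ne (a := κ) (b := κ + 1) (x := κ + 1 + 1) (by omega)
        (by omega)]
      simp
      rw [if_neg (by omega)]
      ring
    · rw [Equiv.swap_apply_of_ne_of_ne (x := t + 1) (by omega) (by omega),
        Equiv.swap_apply_of_ne_of_ne (x := t) (by omega) (by omega)]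
      simp [h1, h2, h3]

/-! ### The hook formula for skyscrapers -/

/-- The sum of the diagonal weights `W (t + 1) - W t` over the hook of `b`, which runs through the
diagonals from `A.rowLen b.1 - b.1` to `b.2 - A.colLen b.2`. -/
def hookWeight (A : YoungDiagram) (W : ℤ → ℤ) (b : ℕ × ℕ) : ℤ :=
  W (b.2 - A.colLen b.2 + 1) - W (A.rowLen b.1 - b.1)

section Corner

variable {r s m n : ℕ} {A A' : YoungDiagram}

namespace IsCorner

lemma rowLen_self (h : IsCorner A A' m n r s) : A.rowLen r = s := by
  refine eq_of_forall_lt_iff fun j => ?_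
  rw [← YoungDiagram.mem_iff_lt_rowLen]
  exact ⟨fun hj => not_le.1 fun hs => h.notMem_of_le le_rfl hs hj, h.mem_of_lt_col⟩

lemma colLen_self (h : IsCorner A A' m n r s) : A.colLen s = r := by
  refine eq_of_forall_lt_iff fun j => ?_
  rw [← YoungDiagram.mem_iff_lt_colLen]
  exact ⟨fun hj => not_le.1 fun hs => h.notMem_of_le hs le_rfl hj, h.mem_of_lt_row⟩

lemma rowLen_eq (h : IsCorner A A' m n r s) (i : ℕ) :
    A'.rowLen i = if i = r then s + 1 else A.rowLen i := by
  refine eq_of_forall_lt_iff fun j => ?_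
  rw [← YoungDiagram.mem_iff_lt_rowLen, h.mem_iff, YoungDiagram.mem_iff_lt_rowLen]
  split_ifs with hi
  · subst hi
    rw [h.rowLen_self]
    simp only [Prod.mk.injEq, true_and]; omega
  · simp [hi]

lemma colLen_eq (h : IsCorner A A' m n r s) (j : ℕ) :
    A'.colLen j = if j = s then r + 1 else A.colLen j := by
  refine eq_of_forall_lt_iff fun i => ?_
  rw [← YoungDiagram.mem_iff_lt_colLen, h.mem_iff, YoungDiagram.mem_iff_lt_colLen]
  split_ifs with hi
  · subst hi
    rw [h.colLen_self]
    simp only [Prod.mk.injEq, and_true]; omega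
  · simp [hi]

lemma hookWeight_self (h : IsCorner A A' m n r s) (W : ℤ → ℤ) :
    hookWeight A W (r, s) = W (s - r + 1) - W (s - r) := by
  simp [hookWeight, h.rowLen_self, h.colLen_self]

/-- Hook weights of the remaining cells do not change when the corner is added to `A` and the two
values of `W` are exchanged: the ends of the hooks that meet the row or the column of the
corner move exactly as the transposition prescribes, and all others avoid the two points. -/
lemma hookWeight_swap (h : IsCorner A A' m n r s) (W : ℤ → ℤ) (b : ℕ × ℕ) :
    hookWeight A' (W ∘ Equiv.swap ((s : ℤ) - r) (s - r + 1)) b = hookWeight A W b := by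
  obtain ⟨i, j⟩ := b
  have hrow : Equiv.swap ((s : ℤ) - r) (s - r + 1) (A'.rowLen i - i) = A.rowLen i - i := by
    rw [h.rowLen_eq]
    rcases lt_trichotomy i r with hi | rfl | hi
    · have h1 := YoungDiagram.mem_iff_lt_rowLen.1 (h.mem_of_lt_row hi)
      rw [if_neg (by omega), Equiv.swap_apply_of_ne_of_ne (by omega) (by omega)]
    · rw [if_pos rfl, h.rowLen_self,
        show ((s + 1 : ℕ) : ℤ) - i = s - i + 1 by omega, Equiv.swap_apply_right]
    · have h1 := A.rowLen_anti _ _ hi.le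
      rw [h.rowLen_self] at h1
      rw [if_neg (by omega), Equiv.swap_apply_of_ne_of_ne (by omega) (by omega)]
  have hcol : Equiv.swap ((s : ℤ) - r) (s - r + 1) (j - A'.colLen j + 1) = j - A.colLen j + 1 := by
    rw [h.colLen_eq]
    rcases lt_trichotomy j s with hj | rfl | hj
    · have h1 := YoungDiagram.mem_iff_lt_colLen.1 (h.mem_of_lt_col hj)
      rw [if_neg (by omega), Equiv.swap_apply_of_ne_of_ne (by omega) (by omega)]
    · rw [if_pos rfl, h.colLen_self,
        show (j : ℤ) - ((r + 1 : ℕ) : ℤ) + 1 = j - r by omega, Equiv.swap_apply_left]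
    · have h1 := A.colLen_anti _ _ hj.le
      rw [h.colLen_self] at h1
      rw [if_neg (by omega), Equiv.swap_apply_of_ne_of_ne (by omega) (by omega)]
  simp only [hookWeight, Function.comp, hrow, hcol]

end IsCorner

lemma exists_isCorner (hne : ((rectangle m n).cells \ A.cells).Nonempty) :
    ∃ r s A', IsCorner A A' m n r s := by
  obtain ⟨⟨r, s⟩, hc⟩ := Finset.exists_minimal hne
  have h1 := mem_sdiff.1 hc.1
  have h2 : r < m ∧ s < n := mem_rectangle.1 h1.1
  refine ⟨r, s, ⟨insert (r, s) A.cells, ?_⟩, h1.2, ?_, h2.1, h2.2⟩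
  · intro a b hba ha
    simp only [coe_insert, Set.mem_insert_iff, mem_coe] at ha ⊢
    rcases ha with rfl | ha
    · by_cases hb : b ∈ A.cells
      · exact Or.inr hb
      · have hb' : b ∈ (rectangle m n).cells := (rectangle m n).isLowerSet hba h1.1
        exact Or.inl (le_antisymm hba (hc.2 (mem_sdiff.2 ⟨hb', hb⟩) hba))
    · exact Or.inr (A.isLowerSet hba ha)
  · intro c
    rw [← YoungDiagram.mem_cells, ← YoungDiagram.mem_cells]
    exact mem_insert

end Corner

/-- Gansner's multivariate hook formula, specialized to weights that depend on the diagonal. The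
exponents may be negative, hence the inner sums are not evaluated here. The induction moves the
cells of the rectangle into `A` one at a time. -/
theorem tsum_zpow_diagWeight {m n : ℕ} {x : ℝ≥0∞} (hx0 : x ≠ 0) (hx : x ≠ ⊤) (A : YoungDiagram)
    (hA : A ≤ rectangle m n) (W : ℤ → ℤ) :
    ∑' S : {S // IsPadded A m n S}, x ^ diagWeight W m n S.1 =
      ∏ b ∈ (rectangle m n).cells \ A.cells, ∑' k : ℕ, x ^ ((k : ℤ) * hookWeight A W b) := by
  induction hN : #((rectangle m n).cells \ A.cells) generalizing A W with
  | zero =>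
    rw [card_eq_zero] at hN
    have hsub : ∀ c, c ∈ rectangle m n → c ∈ A := fun c hc => by
      by_contra h
      have : c ∈ (rectangle m n).cells \ A.cells := mem_sdiff.2 ⟨hc, h⟩
      simp [hN] at this
    have hz : ∀ S, IsPadded A m n S ↔ S = 0 := by
      intro S
      refine ⟨fun hS => ?_, ?_⟩
      · funext ⟨i, j⟩
        by_cases hc : m ≤ i ∨ n ≤ j
        · exact hS.outer i j hc
        · refine hS.inner _ (hsub _ ?_)
          rw [mem_rectangle]; omega
      · rintro rfl
        exact ⟨fun _ _ => rfl, fun _ _ _ => rfl, fun _ _ _ => le_rfl, fun _ _ _ => le_rfl⟩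
    rw [hN, prod_empty, tsum_eq_single ⟨0, (hz 0).2 rfl⟩
      (fun S hS => absurd (Subtype.ext ((hz _).1 S.2)) hS)]
    simp [diagWeight]
  | succ N ih =>
    obtain ⟨r, s, A', h⟩ := exists_isCorner (m := m) (n := n) (A := A) (card_pos.1 (by omega))
    have hins : (rectangle m n).cells \ A.cells =
        insert (r, s) ((rectangle m n).cells \ A'.cells) := by
      ext c
      have hc := h.mem_iff c
      have hrs : (r, s) ∈ rectangle m n := mem_rectangle.2 ⟨h.lt_row, h.lt_col⟩
      have hA := h.notMem
      simp only [mem_sdiff, mem_insert, YoungDiagram.mem_cells, hc]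
      by_cases hcr : c = (r, s)
      · subst hcr; simp [hrs, hA]
      · simp [hcr]
    have hnot : (r, s) ∉ (rectangle m n).cells \ A'.cells := fun hc =>
      (mem_sdiff.1 hc).2 ((h.mem_iff _).2 (Or.inl rfl))
    have hA' : A' ≤ rectangle m n := by
      intro c hc
      rcases (h.mem_iff c).1 hc with rfl | hc
      · exact mem_rectangle.2 ⟨h.lt_row, h.lt_col⟩
      · exact hA hc
    have hcard : #((rectangle m n).cells \ A'.cells) = N := by
      rw [hins, card_insert_of_notMem hnot] at hN; omega
    rw [← (toggleEquiv h).symm.tsum_eq, ENNReal.tsum_prod', hins, prod_insert hnot,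
      h.hookWeight_self, ← ENNReal.tsum_mul_right]
    refine tsum_congr fun k => ?_
    have hrec := ih A' hA' (W ∘ Equiv.swap ((s : ℤ) - r) (s - r + 1)) hcard
    simp only [h.hookWeight_swap] at hrec
    rw [← hrec, ← ENNReal.tsum_mul_left]
    refine tsum_congr fun S => ?_
    rw [← ENNReal.zpow_add hx0 hx]
    congr 1
    exact diagWeight_toggle h S.2 W k

lemma hookWeight_id {m n : ℕ} {A : YoungDiagram} {b : ℕ × ℕ}
    (hb : b ∈ (rectangle m n).cells \ A.cells) :
    hookWeight A id b = hookLength A (rectangle m n) b := by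
  obtain ⟨i, j⟩ := b
  have hb1 : i < m ∧ j < n := mem_rectangle.1 ((mem_sdiff.1 hb).1)
  have hb2 : (i, j) ∉ A := (mem_sdiff.1 hb).2
  have hr : A.rowLen i ≤ j := not_lt.1 fun h => hb2 (YoungDiagram.mem_iff_lt_rowLen.2 h)
  have hc : A.colLen j ≤ i := not_lt.1 fun h => hb2 (YoungDiagram.mem_iff_lt_colLen.2 h)
  have h1 : #{c ∈ (rectangle m n).cells \ A.cells | c.1 = i ∧ c.2 < j} = j - A.rowLen i := by
    rw [← Nat.card_Ico, ← card_image_of_injective (Ico _ _) (Prod.mk_right_injective i)]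
    congr 1
    ext ⟨i', j'⟩
    simp only [mem_filter, mem_sdiff, YoungDiagram.mem_cells, mem_rectangle, mem_image, mem_Ico,
      Prod.mk.injEq]
    rw [YoungDiagram.mem_iff_lt_rowLen]
    constructor
    · rintro ⟨⟨h1, h2⟩, rfl, h3⟩
      exact ⟨j', by omega, rfl, rfl⟩
    · rintro ⟨k, hk, rfl, rfl⟩
      omega
  have h2 : #{c ∈ (rectangle m n).cells \ A.cells | c.2 = j ∧ c.1 < i} = i - A.colLen j := by
    rw [← Nat.card_Ico, ← card_image_of_injective (Ico _ _) (Prod.mk_left_injective j)]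
    congr 1
    ext ⟨i', j'⟩
    simp only [mem_filter, mem_sdiff, YoungDiagram.mem_cells, mem_rectangle, mem_image, mem_Ico,
      Prod.mk.injEq]
    rw [YoungDiagram.mem_iff_lt_colLen]
    constructor
    · rintro ⟨⟨h1, h2⟩, rfl, h3⟩
      exact ⟨i', by omega, rfl, rfl⟩
    · rintro ⟨k, hk, rfl, rfl⟩
      omega
  simp only [hookWeight, hookLength, h1, h2, id]
  omega

section Padded

variable {m n : ℕ} {A : YoungDiagram}

open Classical in
/-- Extension by `0` to the cells of `A`. -/
noncomputable def pad (S : Outside A → ℕ) (c : ℕ × ℕ) : ℕ := if h : c ∉ A then S ⟨c, h⟩ else 0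

lemma IsPadded.antitone {S : ℕ × ℕ → ℕ} (hS : IsPadded A m n S) {c d : ℕ × ℕ} (hc : c ∉ A)
    (h : c ≤ d) : S d ≤ S c := by
  obtain ⟨i, j⟩ := c
  obtain ⟨i', j'⟩ := d
  obtain ⟨k, rfl⟩ := Nat.exists_eq_add_of_le h.1
  obtain ⟨l, rfl⟩ := Nat.exists_eq_add_of_le h.2
  have hmem : ∀ k l, (i + k, j + l) ∉ A := fun k l hkl =>
    hc (A.up_left_mem (by omega) (by omega) hkl)
  have h1 : Antitone fun k => S (i + k, j + l) :=
    antitone_nat_of_succ_le fun k => hS.col _ _ (hmem k l)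
  have h2 : Antitone fun l => S (i, j + l) :=
    antitone_nat_of_succ_le fun l => hS.row _ _ (hmem 0 l)
  exact (h1 (Nat.zero_le k)).trans (h2 (Nat.zero_le l))

/-- Skyscrapers are the same as their extensions by `0`. -/
noncomputable def padEquiv :
    {S : Outside A → ℕ // IsSkyscraper A (rectangle m n) S} ≃ {S // IsPadded A m n S} where
  toFun S := ⟨pad S.1, by
    refine ⟨fun c hc => by simp [pad, hc], fun i j hij => ?_, fun i j hij => ?_, fun i j hij => ?_⟩
    · by_cases hc : (i, j) ∈ A
      · simp [pad, hc]
      · simp only [pad, hc, not_false_eq_true, dif_pos]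
        exact S.2.eq_zero _ (by rw [mem_rectangle]; omega)
    · have h' : (i, j + 1) ∉ A := fun h => hij (A.up_left_mem le_rfl (by omega) h)
      simp only [pad, hij, h', not_false_eq_true, dif_pos]
      exact S.2.antitone (Subtype.mk_le_mk.2 (Prod.mk_le_mk.2 ⟨le_rfl, by omega⟩))
    · have h' : (i + 1, j) ∉ A := fun h => hij (A.up_left_mem (by omega) le_rfl h)
      simp only [pad, hij, h', not_false_eq_true, dif_pos]
      exact S.2.antitone (Subtype.mk_le_mk.2 (Prod.mk_le_mk.2 ⟨by omega, le_rfl⟩))⟩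
  invFun S := ⟨fun c => S.1 c.1, by
    refine ⟨fun c d hcd => S.2.antitone c.2 hcd, ?_⟩
    rintro ⟨⟨i, j⟩, hc⟩ hB
    rw [mem_rectangle] at hB
    exact S.2.outer _ _ (by omega)⟩
  left_inv S := by
    ext c
    simp [pad, c.2]
  right_inv S := by
    ext c
    by_cases hc : c ∈ A
    · simp [pad, hc, S.2.inner c hc]
    · simp [pad, hc]

lemma vol_eq_sum {B : YoungDiagram} {S : Outside A → ℕ}
    (hS : ∀ c : Outside A, c.1 ∉ B → S c = 0) :
    vol S = ∑ c : {c // c ∈ B.cells \ A.cells}, S ⟨c.1, (mem_sdiff.1 c.2).2⟩ := by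
  let e : {c // c ∈ B.cells \ A.cells} ↪ Outside A :=
    ⟨fun c => ⟨c.1, (mem_sdiff.1 c.2).2⟩, fun c d hcd =>
      Subtype.ext (congrArg (fun c : Outside A => c.1) hcd)⟩
  rw [vol, finsum_eq_sum_of_support_subset (s := univ.map e), sum_map]
  · rfl
  · intro c hc
    have hB : c.1 ∈ B := by
      by_contra h
      exact hc (hS c h)
    simp only [coe_map, coe_univ, Set.image_univ, Set.mem_range]
    exact ⟨⟨c.1, mem_sdiff.2 ⟨hB, c.2⟩⟩, rfl⟩

lemma diagWeight_pad {S : Outside A → ℕ} (hS : IsSkyscraper A (rectangle m n) S) :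
    diagWeight id m n (pad S) = vol S := by
  have h1 : ∀ c : {c // c ∈ (rectangle m n).cells \ A.cells},
      S ⟨c.1, (mem_sdiff.1 c.2).2⟩ = pad S c.1 := by
    intro c
    have hc : c.1 ∉ A := (mem_sdiff.1 c.2).2
    simp [pad, hc]
  rw [vol_eq_sum hS.eq_zero, sum_congr rfl fun c _ => h1 c,
    sum_coe_sort ((rectangle m n).cells \ A.cells) (pad S), diagWeight, Nat.cast_sum]
  symm
  refine sum_subset_zero_on_sdiff sdiff_subset ?_ fun c _ => by simp
  intro c hc
  have hcA : c ∈ A := by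
    by_contra h
    exact (mem_sdiff.1 hc).2 (mem_sdiff.2 ⟨(mem_sdiff.1 hc).1, h⟩)
  simp [pad, hcA]

/-- Stanley's hook formula for the generating function of all skyscrapers. -/
theorem tsum_pow_vol {x : ℝ≥0∞} (hx0 : x ≠ 0) (hx : x ≠ ⊤) (hA : A ≤ rectangle m n) :
    ∑' S : {S : Outside A → ℕ // IsSkyscraper A (rectangle m n) S}, x ^ vol S.1 =
      ∏ b ∈ (rectangle m n).cells \ A.cells,
        (1 - x ^ hookLength A (rectangle m n) b)⁻¹ := by
  have h1 := tsum_zpow_diagWeight hx0 hx A hA id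
  rw [← padEquiv.tsum_eq] at h1
  calc _ = _ := tsum_congr fun S => ?_
    _ = _ := h1
    _ = _ := prod_congr rfl fun b hb => ?_
  · rw [← zpow_natCast, ← diagWeight_pad S.2]
    rfl
  · rw [hookWeight_id hb, ← ENNReal.tsum_geometric]
    refine tsum_congr fun k => ?_
    rw [← pow_mul, ← zpow_natCast]
    push_cast
    rw [mul_comm]

end Padded

/-! ### Pedestals -/

section Pedestals

variable {e : ℕ ≃ ℕ × ℕ} {A B : YoungDiagram} {P Q S : Outside A → ℕ} {c d f : Outside A}

lemma PrecedesIn.le (h : PrecedesIn e S c d) : S d ≤ S c := h.elim le_of_lt fun h => h.1.ge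

lemma PrecedesIn.trans (h : PrecedesIn e S c d) (h' : PrecedesIn e S d f) :
    PrecedesIn e S c f := by
  unfold PrecedesIn Precedes at *
  omega

lemma PrecedesIn.asymm (h : PrecedesIn e S c d) : ¬ PrecedesIn e S d c := by
  unfold PrecedesIn Precedes at *
  omega

lemma precedesIn_trichotomy (e : ℕ ≃ ℕ × ℕ) (S : Outside A → ℕ) (c d : Outside A) :
    PrecedesIn e S c d ∨ c = d ∨ PrecedesIn e S d c := by
  have h : c = d ↔ e.symm c.1 = e.symm d.1 := by rw [e.symm.injective.eq_iff, Subtype.ext_iff]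
  rw [h]
  unfold PrecedesIn Precedes
  omega

lemma Equivalent.of_imp (h : ∀ c d, PrecedesIn e P c d → PrecedesIn e Q c d) :
    Equivalent e Q P := by
  intro c d
  refine ⟨fun hQ => ?_, h c d⟩
  rcases precedesIn_trichotomy e P c d with h1 | rfl | h1
  · exact h1
  · exact absurd hQ hQ.asymm
  · exact absurd (h _ _ h1) hQ.asymm

lemma Equivalent.symm (h : Equivalent e S Q) : Equivalent e Q S := fun c d => (h c d).symm

lemma Equivalent.trans (h : Equivalent e S Q) (h' : Equivalent e Q P) : Equivalent e S P :=
  fun c d => (h c d).trans (h' c d)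

lemma IsAllowed.precedes (he : IsAllowed e) {c d : ℕ × ℕ} (h : c < d) : Precedes e c d := by
  by_contra hn
  have hne : e.symm c ≠ e.symm d := fun h' => h.ne (e.symm.injective h')
  have h1 := (he (e.symm d + 2)).1 h.le
  unfold Precedes at hn
  simp only at h1
  omega

/-- A comparable pair of cells is ordered the same way by `≻` and by every `≻_P`, so that
monotonicity along `≻_P` implies antitonicity. -/
lemma IsSkyscraper.of_precedesIn (he : IsAllowed e) (hP : IsSkyscraper A B P)
    (h : ∀ c d, PrecedesIn e P c d → Q d ≤ Q c) (h0 : ∀ c : Outside A, c.1 ∉ B → Q c = 0) :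
    IsSkyscraper A B Q := by
  refine ⟨fun c d hcd => ?_, h0⟩
  rcases hcd.eq_or_lt with rfl | hlt
  · exact le_rfl
  · refine h c d ?_
    have h1 := hP.antitone hcd
    have h2 := he.precedes (c := c.1) (d := d.1) hlt
    rcases h1.eq_or_lt with h3 | h3
    · exact Or.inr ⟨h3.symm, h2⟩
    · exact Or.inl h3

/-- Every class contains a pedestal, namely the pointwise infimum of its members. -/
theorem exists_pedestal (he : IsAllowed e) (hS : IsSkyscraper A B S) :
    ∃ P ∈ pedestals e A B, Equivalent e S P := by
  let T : Set (Outside A → ℕ) := {S' | IsSkyscraper A B S' ∧ Equivalent e S' S}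
  have hST : S ∈ T := ⟨hS, fun _ _ => Iff.rfl⟩
  let P : Outside A → ℕ := fun c => sInf ((fun S' => S' c) '' T)
  have hmem : ∀ c, ∃ S' ∈ T, S' c = P c := fun c =>
    Nat.sInf_mem (Set.Nonempty.image (fun S' : Outside A → ℕ => S' c) ⟨S, hST⟩)
  have hle : ∀ S' ∈ T, ∀ c, P c ≤ S' c := fun S' hS' c => Nat.sInf_le ⟨S', hS', rfl⟩
  -- Compare `P` at the two cells with a member of the class that attains the infimum at `c`.
  have hprec : ∀ c d, PrecedesIn e S c d → PrecedesIn e P c d := by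
    intro c d hcd
    obtain ⟨S', hS', h1⟩ := hmem c
    have h2 := (hS'.2 c d).2 hcd
    have h3 := hle S' hS' d
    unfold PrecedesIn Precedes at *
    omega
  have hequiv : Equivalent e P S := Equivalent.of_imp hprec
  refine ⟨P, ⟨?_, fun S' hS' hS'P c => hle S' ⟨hS', hS'P.trans hequiv⟩ c⟩, hequiv.symm⟩
  exact hS.of_precedesIn he (fun c d hcd => (hprec c d hcd).le) fun c hc =>
    Nat.eq_zero_of_le_zero ((hle S hST c).trans (hS.eq_zero c hc).le)

lemma pedestal_ext (hP : P ∈ pedestals e A B) (hQ : Q ∈ pedestals e A B)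
    (h : Equivalent e P Q) : P = Q :=
  funext fun c => le_antisymm (hP.2 Q hQ.1 h.symm c) (hQ.2 P hP.1 h c)

/-- The difference of a skyscraper and its pedestal is non-increasing along the ordering of
the cells. -/
theorem pedestal_sub_le (he : IsAllowed e) (hP : P ∈ pedestals e A B) (hS : IsSkyscraper A B S)
    (h : Equivalent e S P) (hcd : PrecedesIn e P c d) : S d - P d ≤ S c - P c := by
  classical
  by_contra hlt
  have hPS := hP.2 S hS h
  -- Otherwise lower `P` on the cells up to `d` to the minimum of `P` and `S - t - 1`, where
  -- `t = S c - P c`. The value at `d` survives and the one at `c` drops, and the ordering is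
  -- the same, which contradicts the minimality of `P`.
  let Q : Outside A → ℕ := fun x =>
    if x = d ∨ PrecedesIn e P x d then min (P x) (S x - (S c - P c) - 1) else P x
  have hQP : ∀ x, Q x ≤ P x := by
    intro x
    simp only [Q]
    split_ifs
    · exact min_le_left _ _
    · exact le_rfl
  have hSd : ∀ x, x = d ∨ PrecedesIn e P x d → S d ≤ S x := by
    rintro x (rfl | hx)
    · exact le_rfl
    · exact ((h x d).2 hx).le
  have hQd : Q d = P d := by
    simp only [Q, true_or, if_true]
    omega
  have hup : ∀ x y, (y = d ∨ PrecedesIn e P y d) → PrecedesIn e P x y → PrecedesIn e Q x y := by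
    intro x y hy hxy
    have hx : x = d ∨ PrecedesIn e P x d := by
      rcases hy with rfl | hy
      · exact Or.inr hxy
      · exact Or.inr (hxy.trans hy)
    have h1 := (h x y).2 hxy
    have h2 := hSd y hy
    unfold PrecedesIn Precedes at h1 hxy ⊢
    have h3 := hPS x
    have h4 := hPS y
    have h5 := hPS d
    simp only [Q, hx, hy, if_true]
    omega
  have hprec : ∀ x y, PrecedesIn e P x y → PrecedesIn e Q x y := by
    intro x y hxy
    by_cases hy : y = d ∨ PrecedesIn e P y d
    · exact hup x y hy hxy
    have hQy : Q y = P y := if_neg hy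
    by_cases hx : x = d ∨ PrecedesIn e P x d
    · have hdy : PrecedesIn e Q d y := by
        rcases precedesIn_trichotomy e P d y with h1 | h1 | h1
        · simpa only [PrecedesIn, hQd, hQy] using h1
        · exact absurd (Or.inl h1.symm) hy
        · exact absurd (Or.inr h1) hy
      rcases hx with rfl | hx
      · exact hdy
      · exact (hup x d (Or.inl rfl) hx).trans hdy
    · have hQx : Q x = P x := if_neg hx
      simpa only [PrecedesIn, hQx, hQy] using hxy
  have hQ : IsSkyscraper A B Q := hP.1.of_precedesIn he (fun c d hcd => (hprec c d hcd).le)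
    fun c hc => Nat.eq_zero_of_le_zero ((hQP c).trans (hP.1.eq_zero c hc).le)
  have hQc : Q c = min (P c) (S c - (S c - P c) - 1) := if_pos (Or.inr hcd)
  have h1 := hP.2 Q hQ (Equivalent.of_imp hprec) c
  have h2 := hPS c
  have h3 := hSd c (Or.inr hcd)
  omega

/-- Functions that are non-increasing along the ordering `≻_P` and vanish outside `B`. -/
def Compatible (e : ℕ ≃ ℕ × ℕ) (B : YoungDiagram) (P τ : Outside A → ℕ) : Prop :=
  (∀ c d, PrecedesIn e P c d → τ d ≤ τ c) ∧ ∀ c : Outside A, c.1 ∉ B → τ c = 0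

lemma Compatible.equivalent {τ : Outside A → ℕ} (hτ : Compatible e B P τ) :
    Equivalent e (P + τ) P := by
  refine Equivalent.of_imp fun c d hcd => ?_
  have h1 := hτ.1 c d hcd
  unfold PrecedesIn Precedes at *
  simp only [Pi.add_apply]
  omega

/-- Every skyscraper is, in a unique way, a pedestal plus a function compatible with it. -/
noncomputable def pedestalEquiv (he : IsAllowed e) (A B : YoungDiagram) :
    (Σ P : pedestals e A B, {τ : Outside A → ℕ // Compatible e B P.1 τ}) ≃
      {S : Outside A → ℕ // IsSkyscraper A B S} :=
  Equiv.ofBijective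
    (fun p => ⟨p.1.1 + p.2.1, p.1.2.1.of_precedesIn he
      (fun c d hcd => add_le_add hcd.le (p.2.2.1 c d hcd))
      fun c hc => by simp [p.1.2.1.eq_zero c hc, p.2.2.2 c hc]⟩) <| by
    constructor
    · rintro ⟨⟨P, hP⟩, τ, hτ⟩ ⟨⟨Q, hQ⟩, σ, hσ⟩ h
      have h' : P + τ = Q + σ := congrArg Subtype.val h
      obtain rfl : P = Q := pedestal_ext hP hQ
        (hτ.equivalent.symm.trans (h' ▸ hσ.equivalent))
      obtain rfl : τ = σ := add_left_cancel h'
      rfl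
    · rintro ⟨S, hS⟩
      obtain ⟨P, hP, hSP⟩ := exists_pedestal he hS
      have hle := hP.2 S hS hSP
      refine ⟨⟨⟨P, hP⟩, fun c => S c - P c, fun c d hcd => pedestal_sub_le he hP hS hSP hcd,
        fun c hc => by simp [hS.eq_zero c hc]⟩, Subtype.ext (funext fun c => ?_)⟩
      exact Nat.add_sub_of_le (hle c)

lemma vol_add (hP : ∀ c : Outside A, c.1 ∉ B → P c = 0) (hQ : ∀ c : Outside A, c.1 ∉ B → Q c = 0) :
    vol (P + Q) = vol P + vol Q := by
  rw [vol_eq_sum hP, vol_eq_sum hQ, vol_eq_sum (B := B), ← sum_add_distrib]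
  · rfl
  · intro c hc
    simp [hP c hc, hQ c hc]

lemma IsSkyscraper.mem_of_precedesIn (he : IsAllowedFor A B e) (hP : IsSkyscraper A B P)
    (h : PrecedesIn e P c d) (hd : d.1 ∈ B) : c.1 ∈ B := by
  by_contra hc
  have h1 := he.outer_last _ hd _ hc
  have h2 := hP.eq_zero c hc
  unfold PrecedesIn Precedes at *
  omega

/-- A pedestal is determined by the ordering which it induces on the finite set `B \ A`. -/
theorem finite_pedestals (he : IsAllowedFor A B e) : (pedestals e A B).Finite := by
  let D := {c // c ∈ B.cells \ A.cells}
  let i : D → Outside A := fun c => ⟨c.1, (mem_sdiff.1 c.2).2⟩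
  have hi : ∀ c : Outside A, c.1 ∈ B → ∃ c', i c' = c := fun c hc =>
    ⟨⟨c.1, mem_sdiff.2 ⟨hc, c.2⟩⟩, rfl⟩
  -- Cells outside `B` have height `0` and come last, so the ordering of `B \ A` is all that matters.
  let F : (Outside A → ℕ) → Set (D × D) := fun P => {p | PrecedesIn e P (i p.1) (i p.2)}
  refine Set.Finite.of_finite_image (f := F) (Set.toFinite _) ?_
  intro P hP Q hQ hPQ
  have key : ∀ {P Q : Outside A → ℕ}, P ∈ pedestals e A B → Q ∈ pedestals e A B → F P = F Q →
      ∀ c d, PrecedesIn e P c d → PrecedesIn e Q c d := by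
    intro P Q hP hQ hPQ c d hcd
    by_cases hd : d.1 ∈ B
    · obtain ⟨c, rfl⟩ := hi c (hP.1.mem_of_precedesIn he hcd hd)
      obtain ⟨d, rfl⟩ := hi d hd
      have : (c, d) ∈ F P := hcd
      rw [hPQ] at this
      exact this
    · have h1 := hP.1.eq_zero d hd
      have h2 := hQ.1.eq_zero d hd
      by_cases hc : c.1 ∈ B
      · have h3 := he.outer_last _ hc _ hd
        unfold PrecedesIn
        rcases Nat.eq_zero_or_pos (Q c) with h4 | h4
        · exact Or.inr ⟨by omega, h3⟩
        · exact Or.inl (by omega)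
      · have h3 := hP.1.eq_zero c hc
        have h4 := hQ.1.eq_zero c hc
        unfold PrecedesIn Precedes at *
        omega
  exact pedestal_ext hP hQ (Equivalent.of_imp (key hQ hP hPQ.symm))

end Pedestals

/-! ### Counting monotone functions -/

/-- A monotone sequence of length `N + 1` is its first term together with the excess of the others
over it. -/
def monotoneConsEquiv (N : ℕ) :
    {g : Fin (N + 1) → ℕ // Monotone g} ≃ ℕ × {g : Fin N → ℕ // Monotone g} where
  toFun g := (g.1 0, ⟨fun i => g.1 i.succ - g.1 0, fun i j hij =>
    Nat.sub_le_sub_right (g.2 (Fin.succ_le_succ_iff.2 hij)) _⟩)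
  invFun p := ⟨Fin.cons p.1 fun i => p.1 + p.2.1 i, by
    intro i j
    refine Fin.cases ?_ (fun i => ?_) i <;> refine Fin.cases ?_ (fun j => ?_) j
    · simp
    · simp
    · intro h; simp at h
    · intro h
      simpa using p.2.2 (Fin.succ_le_succ_iff.1 h)⟩
  left_inv g := by
    apply Subtype.ext
    funext i
    refine Fin.cases ?_ (fun i => ?_) i
    · simp
    · simpa using Nat.add_sub_of_le (g.2 (Fin.zero_le i.succ))
  right_inv p := by
    simp

/-- The generating function of partitions into at most `N` parts. -/
lemma tsum_pow_monotone_fin (x : ℝ≥0∞) (N : ℕ) :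
    ∑' g : {g : Fin N → ℕ // Monotone g}, x ^ ∑ i, g.1 i = ∏ l ∈ Icc 1 N, (1 - x ^ l)⁻¹ := by
  induction N with
  | zero =>
    rw [tsum_eq_single ⟨0, fun _ _ _ => le_rfl⟩
      (fun g hg => absurd (Subtype.ext (Subsingleton.elim _ _)) hg)]
    simp
  | succ N ih =>
    rw [← (monotoneConsEquiv N).symm.tsum_eq, ENNReal.tsum_prod', prod_Icc_succ_top (by omega),
      ← ih, mul_comm, ← ENNReal.tsum_geometric, ← ENNReal.tsum_mul_right]
    refine tsum_congr fun k => ?_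
    rw [← ENNReal.tsum_mul_left]
    refine tsum_congr fun g => ?_
    rw [← pow_mul, ← pow_add]
    congr 1
    simp [monotoneConsEquiv, Fin.sum_univ_succ, sum_add_distrib]
    ring

/-- The linear order on `α` is given through an injective key `f`. -/
lemma tsum_pow_monotone {α β : Type*} [Fintype α] [LinearOrder β] (f : α → β)
    (hf : Function.Injective f) (x : ℝ≥0∞) :
    ∑' g : {g : α → ℕ // ∀ a b, f a ≤ f b → g a ≤ g b}, x ^ ∑ a, g.1 a =
      ∏ l ∈ Icc 1 (Fintype.card α), (1 - x ^ l)⁻¹ := by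
  let _ : LinearOrder α := LinearOrder.lift' f hf
  let σ : Fin (Fintype.card α) ≃o α := Fintype.orderIsoFinOfCardEq α rfl
  have hmono : ∀ g : Fin (Fintype.card α) → ℕ,
      Monotone g ↔ ∀ a b, f a ≤ f b → (σ.toEquiv.arrowCongr (Equiv.refl ℕ) g) a ≤
        (σ.toEquiv.arrowCongr (Equiv.refl ℕ) g) b := by
    intro g
    constructor
    · intro hg a b hab
      exact hg (σ.symm.monotone hab)
    · intro hg i j hij
      simpa using hg (σ i) (σ j) (σ.monotone hij)
  rw [← tsum_pow_monotone_fin,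
    ← ((σ.toEquiv.arrowCongr (Equiv.refl ℕ)).subtypeEquiv hmono).tsum_eq]
  refine tsum_congr fun g => ?_
  congr 1
  exact (σ.symm.toEquiv.sum_comp g.1)

section Compat

variable {e : ℕ ≃ ℕ × ℕ} {A B : YoungDiagram} {P : Outside A → ℕ}

/-- The key whose lexicographic order is the reverse of `≻_P`: compare heights first, then positions
in the enumeration. -/
def orderKey (e : ℕ ≃ ℕ × ℕ) (P : Outside A → ℕ)
    (c : Outside A) : ℕ ×ₗ ℕᵒᵈ := toLex (P c, OrderDual.toDual (e.symm c.1))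

lemma orderKey_lt_iff {c d : Outside A} :
    orderKey e P d < orderKey e P c ↔ PrecedesIn e P c d := by
  simp only [orderKey, Prod.Lex.toLex_lt_toLex, OrderDual.toDual_lt_toDual, PrecedesIn, Precedes]
  rw [eq_comm]

lemma orderKey_injective : Function.Injective (orderKey e P) := by
  intro c d h
  rcases precedesIn_trichotomy e P c d with h1 | h1 | h1
  · exact absurd h (orderKey_lt_iff.2 h1).ne'
  · exact h1
  · exact absurd h (orderKey_lt_iff.2 h1).ne

open Classical in
/-- Functions compatible with `P` are the monotone functions on `B \ A`, extended by `0`. -/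
noncomputable def compatibleEquiv (he : IsAllowedFor A B e) (hP : IsSkyscraper A B P) :
    {τ : Outside A → ℕ // Compatible e B P τ} ≃
      {g : {c // c ∈ B.cells \ A.cells} → ℕ //
        ∀ c d, orderKey e P ⟨c.1, (mem_sdiff.1 c.2).2⟩ ≤ orderKey e P ⟨d.1, (mem_sdiff.1 d.2).2⟩ →
          g c ≤ g d} where
  toFun τ := ⟨fun c => τ.1 ⟨c.1, (mem_sdiff.1 c.2).2⟩, by
    intro c d hcd
    rcases hcd.eq_or_lt with h | h
    · exact (congrArg τ.1 (orderKey_injective h)).le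
    · exact τ.2.1 _ _ (orderKey_lt_iff.1 h)⟩
  invFun g := ⟨fun c => if h : c.1 ∈ B then g.1 ⟨c.1, mem_sdiff.2 ⟨h, c.2⟩⟩ else 0, by
    refine ⟨fun c d hcd => ?_, fun c hc => dif_neg hc⟩
    by_cases hd : d.1 ∈ B
    · have hc := hP.mem_of_precedesIn he hcd hd
      simp only [hc, hd, dif_pos]
      exact g.2 _ _ (orderKey_lt_iff.2 hcd).le
    · simp [hd]⟩
  left_inv τ := by
    ext c
    by_cases hc : c.1 ∈ B
    · simp [hc]
    · simp [hc, τ.2.2 c hc]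
  right_inv g := by
    ext c
    have hc : c.1 ∈ B := (mem_sdiff.1 c.2).1
    simp [hc]

lemma tsum_pow_compatible (he : IsAllowedFor A B e) (hP : IsSkyscraper A B P) (x : ℝ≥0∞) :
    ∑' τ : {τ : Outside A → ℕ // Compatible e B P τ}, x ^ vol τ.1 =
      ∏ l ∈ Icc 1 #(B.cells \ A.cells), (1 - x ^ l)⁻¹ := by
  have h := tsum_pow_monotone
    (fun c : {c // c ∈ B.cells \ A.cells} => orderKey e P ⟨c.1, (mem_sdiff.1 c.2).2⟩)
    (fun c d hcd => Subtype.ext (congrArg (fun c : Outside A => c.1) (orderKey_injective hcd))) x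
  rw [Fintype.card_coe] at h
  rw [← h, ← (compatibleEquiv he hP).tsum_eq]
  refine tsum_congr fun τ => ?_
  rw [vol_eq_sum τ.2.2]
  rfl

theorem tsum_pow_vol_eq_mul (he : IsAllowedFor A B e) (x : ℝ≥0∞) :
    ∑' S : {S : Outside A → ℕ // IsSkyscraper A B S}, x ^ vol S.1 =
      (∑' P : pedestals e A B, x ^ vol P.1) * ∏ l ∈ Icc 1 #(B.cells \ A.cells), (1 - x ^ l)⁻¹ := by
  rw [← (pedestalEquiv he.allowed A B).tsum_eq, ENNReal.tsum_sigma', ← ENNReal.tsum_mul_right]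
  refine tsum_congr fun P => ?_
  rw [← tsum_pow_compatible he P.2.1, ← ENNReal.tsum_mul_left]
  refine tsum_congr fun τ => ?_
  rw [← pow_add, ← vol_add P.2.1.eq_zero τ.2.2]
  rfl

end Compat

/-! ### The generating polynomial -/

lemma toReal_prod_one_sub_pow_inv {ι : Type*} (s : Finset ι) (k : ι → ℕ) {t : ℝ} (h0 : 0 < t)
    (h1 : t < 1) :
    (∏ i ∈ s, (1 - ENNReal.ofReal t ^ k i)⁻¹).toReal = (∏ i ∈ s, (1 - t ^ k i))⁻¹ := by
  rw [ENNReal.toReal_prod, ← prod_inv_distrib]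
  refine prod_congr rfl fun i _ => ?_
  have h : ENNReal.ofReal t ^ k i ≤ 1 := pow_le_one' (ENNReal.ofReal_le_one.2 h1.le) _
  rw [ENNReal.toReal_inv, ENNReal.toReal_sub_of_le h (by simp), ENNReal.toReal_pow,
    ENNReal.toReal_ofReal h0.le, ENNReal.toReal_one]

/-- The identity of polynomials follows from its evaluations at all real numbers in `(0, 1)`, where
both power series converge. -/
theorem pedestalPolynomial_mul_prod {m n : ℕ} {A : YoungDiagram} {e : ℕ ≃ ℕ × ℕ}
    (hA : A ≤ rectangle m n) (he : IsAllowedFor A (rectangle m n) e) :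
    pedestalPolynomial e A (rectangle m n) *
        ∏ b ∈ (rectangle m n).cells \ A.cells, (1 - X ^ hookLength A (rectangle m n) b) =
      ∏ l ∈ Icc 1 #((rectangle m n).cells \ A.cells), (1 - X ^ l) := by
  have hfin := finite_pedestals he
  have hpoly : pedestalPolynomial e A (rectangle m n) = ∑ P ∈ hfin.toFinset, X ^ vol P :=
    finsum_mem_eq_finite_toFinset_sum _ hfin
  apply Polynomial.map_injective (algebraMap ℚ ℝ) (algebraMap ℚ ℝ).injective
  refine Polynomial.eq_of_infinite_eval_eq _ _ ((Set.Ioo_infinite (zero_lt_one' ℝ)).mono ?_)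
  rintro t ⟨h0, h1⟩
  have hx0 : ENNReal.ofReal t ≠ 0 := by simpa using h0
  have key := tsum_pow_vol_eq_mul he (ENNReal.ofReal t)
  rw [tsum_pow_vol hx0 ENNReal.ofReal_ne_top hA] at key
  have key' := congrArg ENNReal.toReal key
  have hsum : (∑' P : pedestals e A (rectangle m n), ENNReal.ofReal t ^ vol P.1).toReal =
      ∑ P ∈ hfin.toFinset, t ^ vol P := by
    have : ∑' P : pedestals e A (rectangle m n), ENNReal.ofReal t ^ vol P.1 =
        ∑ P ∈ hfin.toFinset, ENNReal.ofReal t ^ vol P := by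
      rw [← Finset.tsum_subtype hfin.toFinset]
      exact ((Equiv.subtypeEquivRight fun P => hfin.mem_toFinset).tsum_eq
        fun P : pedestals e A (rectangle m n) => ENNReal.ofReal t ^ vol P.1).symm
    rw [this, ENNReal.toReal_sum fun P _ => ENNReal.pow_ne_top ENNReal.ofReal_ne_top]
    simp [ENNReal.toReal_pow, ENNReal.toReal_ofReal h0.le]
  rw [ENNReal.toReal_mul, toReal_prod_one_sub_pow_inv _ _ h0 h1,
    toReal_prod_one_sub_pow_inv _ _ h0 h1, hsum] at key'
  have hne1 : ∏ l ∈ Icc 1 #((rectangle m n).cells \ A.cells), (1 - t ^ l) ≠ 0 :=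
    prod_ne_zero_iff.2 fun l hl =>
      (sub_pos.2 (pow_lt_one₀ h0.le h1 (by have := mem_Icc.1 hl; omega))).ne'
  have hne2 : ∏ b ∈ (rectangle m n).cells \ A.cells, (1 - t ^ hookLength A (rectangle m n) b) ≠ 0 :=
    prod_ne_zero_iff.2 fun b _ =>
      (sub_pos.2 (pow_lt_one₀ h0.le h1 (by unfold hookLength; omega))).ne'
  simp only [Set.mem_ofPred_eq, hpoly, Polynomial.map_mul, Polynomial.map_sum, Polynomial.map_prod,
    Polynomial.map_sub, Polynomial.map_one, Polynomial.map_pow, Polynomial.map_X, eval_mul,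
    eval_prod, eval_finsetSum, eval_sub, eval_one, eval_pow, eval_X]
  field_simp at key'
  linarith

lemma one_sub_X_pow_ne_zero {k : ℕ} (hk : k ≠ 0) : (1 - RatFunc.X ^ k : RatFunc ℚ) ≠ 0 := by
  have h : (1 - X ^ k : ℚ[X]) ≠ 0 := by
    intro h
    have := congrArg (eval 0) h
    simp [hk] at this
  have h2 : (1 - RatFunc.X ^ k : RatFunc ℚ) = algebraMap ℚ[X] (RatFunc ℚ) (1 - X ^ k) := by
    simp
  rw [h2]
  exact RatFunc.algebraMap_ne_zero h

theorem algebraMap_pedestalPolynomial {m n : ℕ} {A : YoungDiagram} {e : ℕ ≃ ℕ × ℕ}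
    (hA : A ≤ rectangle m n) (he : IsAllowedFor A (rectangle m n) e) :
    algebraMap ℚ[X] (RatFunc ℚ) (pedestalPolynomial e A (rectangle m n)) =
      (∏ l ∈ Icc 1 #((rectangle m n).cells \ A.cells), (1 - RatFunc.X ^ l)) /
        ∏ b ∈ (rectangle m n).cells \ A.cells,
          (1 - RatFunc.X ^ hookLength A (rectangle m n) b) := by
  rw [eq_div_iff (prod_ne_zero_iff.2 fun b _ =>
    one_sub_X_pow_ne_zero (by unfold hookLength; omega))]
  have h := congrArg (algebraMap ℚ[X] (RatFunc ℚ)) (pedestalPolynomial_mul_prod hA he)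
  simpa using h

lemma hookLength_bot {m n i j : ℕ} (hi : i < m) (hj : j < n) :
    hookLength ⊥ (rectangle m n) (i, j) = i + j + 1 := by
  have h := hookWeight_id (m := m) (n := n) (A := ⊥) (b := (i, j))
    (mem_sdiff.2 ⟨(YoungDiagram.mem_cells _).2 (mem_rectangle.2 ⟨hi, hj⟩), by simp⟩)
  have h1 : (⊥ : YoungDiagram).rowLen i = 0 := by
    by_contra h1
    exact YoungDiagram.notMem_bot _ (YoungDiagram.mem_iff_lt_rowLen.2 (Nat.pos_of_ne_zero h1))
  have h2 : (⊥ : YoungDiagram).colLen j = 0 := by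
    by_contra h1
    exact YoungDiagram.notMem_bot _ (YoungDiagram.mem_iff_lt_colLen.2 (Nat.pos_of_ne_zero h1))
  simp only [hookWeight, h1, h2, id] at h
  omega

end Skyscraper

theorem mainTheorem4 :
    (∀ (m n : ℕ) (A B : YoungDiagram) (e : ℕ ≃ ℕ × ℕ),
      B = Skyscraper.rectangle m n → A ≤ B → Skyscraper.IsAllowedFor A B e →
        (Skyscraper.pedestals e A B).Finite ∧
        algebraMap ℚ[X] (RatFunc ℚ) (Skyscraper.pedestalPolynomial e A B) =
          (∏ l ∈ Finset.Icc 1 (B.cells \ A.cells).card, (1 - RatFunc.X ^ l)) /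
            ∏ b ∈ B.cells \ A.cells, (1 - RatFunc.X ^ Skyscraper.hookLength A B b)) ∧
    (∀ (m n : ℕ) (e : ℕ ≃ ℕ × ℕ),
      Skyscraper.IsAllowedFor ⊥ (Skyscraper.rectangle m n) e →
        algebraMap ℚ[X] (RatFunc ℚ)
            (Skyscraper.pedestalPolynomial e ⊥ (Skyscraper.rectangle m n)) =
          (∏ l ∈ Finset.Icc 1 (m * n), (1 - RatFunc.X ^ l)) /
            ∏ i ∈ Finset.Icc 1 m, ∏ j ∈ Finset.Icc 1 n, (1 - RatFunc.X ^ (i + j - 1))) := by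
  constructor
  · rintro m n A B e rfl hA he
    exact ⟨Skyscraper.finite_pedestals he, Skyscraper.algebraMap_pedestalPolynomial hA he⟩
  · intro m n e he
    rw [Skyscraper.algebraMap_pedestalPolynomial bot_le he]
    have hcells : (Skyscraper.rectangle m n).cells \ (⊥ : YoungDiagram).cells =
        range m ×ˢ range n := by
      simp [Skyscraper.rectangle]
    have hIcc : ∀ (k : ℕ) (f : ℕ → RatFunc ℚ), ∏ i ∈ Icc 1 k, f i = ∏ i ∈ range k, f (i + 1) := by
      intro k f
      rw [range_eq_Ico, prod_Ico_add' f 0 k 1]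
      rfl
    rw [hcells, card_product, card_range, card_range, prod_product, hIcc m]
    congr 1
    refine prod_congr rfl fun i hi => ?_
    rw [hIcc n]
    refine prod_congr rfl fun j hj => ?_
    rw [Skyscraper.hookLength_bot (mem_range.1 hi) (mem_range.1 hj)]
    congr 2
    omega
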